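/- For every $\eta > 0$ there is a constant $K_\eta > 0$, depending only on $\eta$, such that the following holds. Let $X, Z > 0$ be real numbers, let $\mathcal{C} \subseteq [X/2, X]$ and $\mathcal{A} \subseteq [Z/2, Z]$ be any sets of squarefree natural numbers, and let $W \leq Z$ be any natural number. Then $$\left| \sum_{a \in \mathcal{A}} \sum_{1 \leq w \leq W} \sum_{c \in \mathcal{C}} \mathbf{1}_{cw - au = 1 \text{ for some } u \in \mathbb{Z}} \; - \; \sum_{a \in \mathcal{A}} \frac{1}{\phi(a)} \#\{c \in \mathcal{C} : (c,a)=1\} \, \#\{1 \leq w \leq W : (w,a)=1\} \right| \leq K_\eta \, (XZ)^{\eta} \sqrt{(\#\mathcal{A})(\#\mathcal{C}) \, W \max\{X/Z, Z\}},$$ where $\phi$ is Euler's totient function and $(m,n)$ denotes the greatest common divisor. -/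

import Mathlib

open Classical in
/-- The indicator of the event that `c * w - a * u = 1` for some integer `u`. -/
noncomputable def solvableIndicator (a w c : ℕ) : ℝ :=
  if ∃ u : ℤ, (c : ℤ) * (w : ℤ) - (a : ℤ) * u = 1 then 1 else 0

/-- The sum over `a ∈ A`, `1 ≤ w ≤ W`, `c ∈ C` of the indicator that
`c * w - a * u = 1` for some integer `u`. -/
noncomputable def solutionSum (A C : Finset ℕ) (W : ℕ) : ℝ :=
  ∑ a ∈ A, ∑ w ∈ Finset.Icc 1 W, ∑ c ∈ C, solvableIndicator a w c

/-- The expected main term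
`∑_{a ∈ A} (1/φ(a)) #{c ∈ C : (c,a) = 1} #{1 ≤ w ≤ W : (w,a) = 1}`. -/
noncomputable def solutionMainTerm (A C : Finset ℕ) (W : ℕ) : ℝ :=
  ∑ a ∈ A, 1 / (Nat.totient a : ℝ) *
    ((C.filter (fun c => Nat.Coprime c a)).card : ℝ) *
    (((Finset.Icc 1 W).filter (fun w => Nat.Coprime w a)).card : ℝ)

/-! The condition says `c * w ≡ 1` modulo `a`, so orthogonality writes its indicator as `1/φ(a) ∑_χ
χ(w) χ(c)` over the characters modulo `a`. The trivial character yields the main term exactly; the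
error is the sum over pairs `(a, χ)` with `χ ≠ 1`.

Cauchy-Schwarz over these pairs, with weight `1/φ(a)` and the conductor `q` of `χ` moved from one
factor to the other, leaves two mean squares. In the first, `|∑_w χ(w)|² / q`, full periods cancel,
so Parseval modulo `q` bounds the sum over characters of level `q` by `q W`; the weight `1/q` makes
this `W`, and the passage from `χ` to its primitive inducing character costs only divisor functions
(`sum_ne_one_norm_sq_sum_Icc_div_conductor_le`). With `1/φ(a) ≪ Z^(ε-1)` this factor is `≪ Z^ε #A W
/ Z`.

In the second, `q |∑_c χ(c)|²`, write `a = q r`. Since `φ(q) φ(r) ≤ φ(a)`, the weight is at most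
`1/φ(r)` times `q/φ(q)`, which is the weight of the multiplicative large sieve (`large_sieve`).
Summing over `r` gives `≪ Z^ε (X + Z²) #C`, which is `≪ Z^(1+ε) max(X/Z, Z) #C`
(`sum_totient_inv_mul_conductor_le`). The powers of `Z` cancel in the product. -/

open Finset

/-! ### Divisor, totient and harmonic sum bounds -/

/-- The divisor bound. -/
theorem exists_card_divisors_le_rpow {ε : ℝ} (hε : 0 < ε) :
    ∃ K : ℝ, 1 ≤ K ∧ ∀ n : ℕ, n ≠ 0 → (#n.divisors : ℝ) ≤ K * (n : ℝ) ^ ε := by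
  have hl : 0 < Real.log 2 := Real.log_pos one_lt_two
  -- A prime `p ≥ P` has `p ^ ε ≥ 2`, so its factor `v + 1 ≤ 2 ^ v` costs nothing. Each of the fewer
  -- than `P + 1` smaller primes costs at most `M`, by `1 + x ≤ exp x` at `x = v ε log 2`.
  set M : ℝ := 1 + 1 / (ε * Real.log 2) with hM
  have hM1 : 1 ≤ M := by
    have : 0 < 1 / (ε * Real.log 2) := by positivity
    linarith
  set P : ℕ := ⌈(2 : ℝ) ^ (1 / ε)⌉₊ with hP
  refine ⟨M ^ P, one_le_pow₀ hM1, fun n hn => ?_⟩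
  have hsmall : ∀ (p v : ℕ), 2 ≤ p → ((v : ℝ) + 1) ≤ M * ((p : ℝ) ^ v) ^ ε := by
    intro p v hp
    have h2 : ((2 : ℝ) ^ v) ^ ε ≤ ((p : ℝ) ^ v) ^ ε := by
      have : (2 : ℝ) ≤ p := by exact_mod_cast hp
      gcongr
    have h3 : ((2 : ℝ) ^ v) ^ ε = Real.exp (v * (ε * Real.log 2)) := by
      rw [← Real.rpow_natCast, ← Real.rpow_mul (by norm_num), Real.rpow_def_of_pos two_pos]
      congr 1; ring
    have h4 := Real.add_one_le_exp (v * (ε * Real.log 2))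
    have h5 : (v : ℝ) + 1 ≤ M * (v * (ε * Real.log 2) + 1) := by
      have hc : 0 < ε * Real.log 2 := by positivity
      have : M * (v * (ε * Real.log 2) + 1) =
          v * (ε * Real.log 2) + 1 + v + 1 / (ε * Real.log 2) := by
        rw [hM]; field_simp; ring
      rw [this]
      have : 0 < 1 / (ε * Real.log 2) := by positivity
      have : 0 ≤ v * (ε * Real.log 2) := by positivity
      linarith
    calc (v : ℝ) + 1 ≤ M * (v * (ε * Real.log 2) + 1) := h5
      _ ≤ M * ((p : ℝ) ^ v) ^ ε := by
        gcongr
        linarith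
  have hlarge : ∀ (p v : ℕ), P ≤ p → ((v : ℝ) + 1) ≤ ((p : ℝ) ^ v) ^ ε := by
    intro p v hp
    have h1 : (2 : ℝ) ^ (1 / ε) ≤ p := (Nat.le_ceil _).trans (by exact_mod_cast hp)
    have h2 : (2 : ℝ) ≤ (p : ℝ) ^ ε := by
      calc (2 : ℝ) = ((2 : ℝ) ^ (1 / ε)) ^ ε := by
            rw [← Real.rpow_mul (by norm_num), one_div_mul_cancel hε.ne', Real.rpow_one]
        _ ≤ (p : ℝ) ^ ε := by gcongr
    have h3 : ((p : ℝ) ^ v) ^ ε = ((p : ℝ) ^ ε) ^ v := by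
      rw [← Real.rpow_natCast, ← Real.rpow_mul (by positivity), mul_comm, Real.rpow_mul (by positivity),
        Real.rpow_natCast]
    have h4 : (v : ℝ) + 1 ≤ 2 ^ v := by exact_mod_cast Nat.lt_two_pow_self (n := v)
    rw [h3]
    exact h4.trans (by gcongr)
  have hprod : (n : ℝ) ^ ε = ∏ p ∈ n.primeFactors, ((p : ℝ) ^ n.factorization p) ^ ε := by
    rw [Real.finsetProd_rpow _ _ (fun i _ => by positivity)]
    congr 1
    conv_lhs => rw [← Nat.prod_factorization_pow_eq_self hn]
    simp [Finsupp.prod]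
  rw [Nat.card_divisors hn, hprod]
  push_cast
  calc ∏ p ∈ n.primeFactors, ((n.factorization p : ℝ) + 1)
      ≤ ∏ p ∈ n.primeFactors,
          ((if p < P then M else 1) * ((p : ℝ) ^ n.factorization p) ^ ε) := by
        refine prod_le_prod (fun p _ => by positivity) fun p hp => ?_
        split_ifs with h
        · exact hsmall _ _ (Nat.prime_of_mem_primeFactors hp).two_le
        · rw [one_mul]; exact hlarge _ _ (not_lt.mp h)
    _ = (∏ p ∈ n.primeFactors, if p < P then M else 1) *
          ∏ p ∈ n.primeFactors, ((p : ℝ) ^ n.factorization p) ^ ε := prod_mul_distrib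
    _ ≤ M ^ P * ∏ p ∈ n.primeFactors, ((p : ℝ) ^ n.factorization p) ^ ε := by
        gcongr
        rw [← prod_filter, prod_const]
        refine pow_le_pow_right₀ hM1 ?_
        calc #{p ∈ n.primeFactors | p < P} ≤ #(range P) := card_le_card fun p hp => by
              simpa using (mem_filter.mp hp).2
          _ = P := card_range P

theorem le_card_divisors_mul_totient (n : ℕ) : n ≤ #n.divisors * n.totient := by
  rcases Nat.eq_zero_or_pos n with rfl | hn
  · simp
  calc n = ∑ d ∈ n.divisors, d.totient := (Nat.sum_totient n).symm
    _ ≤ ∑ _d ∈ n.divisors, n.totient := sum_le_sum fun d hd =>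
        Nat.le_of_dvd (Nat.totient_pos.mpr hn) (Nat.totient_dvd_of_dvd (Nat.dvd_of_mem_divisors hd))
    _ = #n.divisors * n.totient := by rw [sum_const, smul_eq_mul]

theorem one_div_totient_le {n : ℕ} (hn : n ≠ 0) :
    1 / (n.totient : ℝ) ≤ #n.divisors / n := by
  have h : (n : ℝ) ≤ #n.divisors * n.totient := by exact_mod_cast le_card_divisors_mul_totient n
  have h1 : (0 : ℝ) < n.totient := by exact_mod_cast Nat.totient_pos.mpr (Nat.pos_of_ne_zero hn)
  have h2 : (0 : ℝ) < n := by positivity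
  rw [div_le_div_iff₀ h1 h2]
  linarith

theorem sum_Icc_one_div_le (M : ℕ) : ∑ k ∈ Icc 1 M, 1 / (k : ℝ) ≤ 1 + Real.log M := by
  have h := harmonic_le_one_add_log M
  rw [harmonic_eq_sum_Icc] at h
  simpa using h

/-! ### The additive large sieve -/

open scoped ComplexConjugate

/-- Schur's test for the Gram matrix of the rows of `K`, transferred to `K` by duality. -/
theorem sum_norm_sq_le_of_gram_row_sum_le {ι κ : Type*} (s : Finset ι) (t : Finset κ)
    (K : ι → κ → ℂ) {D : ℝ} (hD0 : 0 ≤ D)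
    (hD : ∀ i ∈ s, ∑ j ∈ s, ‖∑ n ∈ t, K i n * conj (K j n)‖ ≤ D) (a : κ → ℂ) :
    ∑ i ∈ s, ‖∑ n ∈ t, a n * K i n‖ ^ 2 ≤ D * ∑ n ∈ t, ‖a n‖ ^ 2 := by
  have hdual : ∀ b : ι → ℂ,
      ∑ n ∈ t, ‖∑ i ∈ s, b i * K i n‖ ^ 2 ≤ D * ∑ i ∈ s, ‖b i‖ ^ 2 := by
    intro b
    set F : ι → ι → ℂ := fun i j => ∑ n ∈ t, K i n * conj (K j n) with hF
    have hsymm : ∀ i j, ‖F i j‖ = ‖F j i‖ := by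
      intro i j
      rw [← Complex.norm_conj (F i j)]
      congr 1
      simp only [hF, map_sum, map_mul, Complex.conj_conj]
      exact sum_congr rfl fun _ _ => mul_comm _ _
    have hexp : ((∑ n ∈ t, ‖∑ i ∈ s, b i * K i n‖ ^ 2 : ℝ) : ℂ) =
        ∑ i ∈ s, ∑ j ∈ s, b i * conj (b j) * F i j := by
      push_cast
      simp only [← Complex.mul_conj', map_sum, map_mul, sum_mul_sum]
      rw [sum_comm]
      refine sum_congr rfl fun i _ => ?_
      rw [sum_comm]
      refine sum_congr rfl fun j _ => ?_
      rw [hF, mul_sum]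
      exact sum_congr rfl fun n _ => by ring
    calc ∑ n ∈ t, ‖∑ i ∈ s, b i * K i n‖ ^ 2
        = ‖((∑ n ∈ t, ‖∑ i ∈ s, b i * K i n‖ ^ 2 : ℝ) : ℂ)‖ := by
          rw [Complex.norm_real, Real.norm_of_nonneg (by positivity)]
      _ ≤ ∑ i ∈ s, ∑ j ∈ s, ‖b i‖ * ‖b j‖ * ‖F i j‖ := by
          rw [hexp]
          refine (norm_sum_le _ _).trans (sum_le_sum fun i _ => ?_)
          refine (norm_sum_le _ _).trans (sum_le_sum fun j _ => ?_)
          simp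
      -- AM-GM; the symmetry of `‖F i j‖` turns both halves into row sums.
      _ ≤ ∑ i ∈ s, ∑ j ∈ s, (‖b i‖ ^ 2 / 2 * ‖F i j‖ + ‖b j‖ ^ 2 / 2 * ‖F j i‖) := by
          refine sum_le_sum fun i _ => sum_le_sum fun j _ => ?_
          rw [← hsymm i j, ← add_mul]
          gcongr
          nlinarith [sq_nonneg (‖b i‖ - ‖b j‖)]
      _ = ∑ i ∈ s, ‖b i‖ ^ 2 * ∑ j ∈ s, ‖F i j‖ := by
          simp only [sum_add_distrib]
          rw [sum_comm (f := fun i j => ‖b j‖ ^ 2 / 2 * ‖F j i‖), ← sum_add_distrib]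
          refine sum_congr rfl fun i _ => ?_
          rw [← mul_sum]; ring
      _ ≤ ∑ i ∈ s, ‖b i‖ ^ 2 * D := by
          gcongr with i hi
          exact hD i hi
      _ = D * ∑ i ∈ s, ‖b i‖ ^ 2 := by rw [← sum_mul, mul_comm]
  -- Duality: testing the dual inequality on `b = conj S` gives `T² ≤ (∑ ‖a n‖²) D T`, and one
  -- factor `T` cancels.
  set S : ι → ℂ := fun i => ∑ n ∈ t, a n * K i n with hS
  set T : ℝ := ∑ i ∈ s, ‖S i‖ ^ 2 with hT
  have hT0 : 0 ≤ T := by positivity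
  have hTeq : (T : ℂ) = ∑ n ∈ t, a n * ∑ i ∈ s, conj (S i) * K i n := by
    rw [hT]
    push_cast
    simp only [← Complex.conj_mul', mul_sum]
    rw [sum_comm]
    refine sum_congr rfl fun i _ => ?_
    conv_lhs => rw [hS]
    rw [mul_sum]
    exact sum_congr rfl fun n _ => by ring
  have hTle : T ≤ ∑ n ∈ t, ‖a n‖ * ‖∑ i ∈ s, conj (S i) * K i n‖ := by
    calc T = ‖(T : ℂ)‖ := by rw [Complex.norm_real, Real.norm_of_nonneg hT0]
      _ ≤ _ := by
        rw [hTeq]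
        exact (norm_sum_le _ _).trans (sum_le_sum fun n _ => (norm_mul _ _).le)
  have hsq : T ^ 2 ≤ (∑ n ∈ t, ‖a n‖ ^ 2) * (D * T) := by
    calc T ^ 2 ≤ (∑ n ∈ t, ‖a n‖ * ‖∑ i ∈ s, conj (S i) * K i n‖) ^ 2 := by gcongr
      _ ≤ (∑ n ∈ t, ‖a n‖ ^ 2) * ∑ n ∈ t, ‖∑ i ∈ s, conj (S i) * K i n‖ ^ 2 :=
        sum_mul_sq_le_sq_mul_sq _ _ _
      _ ≤ (∑ n ∈ t, ‖a n‖ ^ 2) * (D * T) := by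
        gcongr
        simpa using hdual fun i => conj (S i)
  rcases hT0.eq_or_lt with h0 | hpos
  · rw [← h0]
    positivity
  · nlinarith

/-- The geometric sum is at most `1 / |sin πθ|`, and Jordan's inequality bounds the sine below by
the distance to the nearest integer. Adding the two one-sided reciprocals avoids a minimum, so that
each can be summed separately by `sum_one_div_fract_le`. -/
theorem norm_sum_exp_le (N : ℕ) {θ : ℝ} (hθ : 0 < Int.fract θ) :
    ‖∑ n ∈ range N, Complex.exp (2 * Real.pi * Complex.I * (n * θ : ℝ))‖ ≤
      1 / Int.fract θ + 1 / Int.fract (-θ) := by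
  set t := Int.fract θ with ht
  have ht1 : t < 1 := Int.fract_lt_one θ
  have hneg : Int.fract (-θ) = 1 - t := Int.fract_neg hθ.ne'
  have hsin : 1 / |Real.sin (Real.pi * θ)| ≤ 1 / t + 1 / (1 - t) ∧ Real.sin (Real.pi * θ) ≠ 0 := by
    have habs : |Real.sin (Real.pi * θ)| = |Real.sin (Real.pi * t)| := by
      have : Real.pi * θ = Real.pi * t + ⌊θ⌋ * Real.pi := by
        rw [ht, ← Int.self_sub_floor]; ring
      rw [this, Real.sin_add_int_mul_pi, abs_mul, abs_zpow, abs_neg, abs_one, one_zpow, one_mul]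
    have hpos1 : 0 < 1 / t := by positivity
    have hpos2 : 0 < 1 / (1 - t) := one_div_pos.mpr (by linarith)
    rw [← abs_pos, habs]
    have hpi := Real.pi_pos
    rcases le_total t (1 / 2) with h | h
    · have h1 : t ≤ |Real.sin (Real.pi * t)| := by
        have := Real.mul_le_sin (x := Real.pi * t) (by positivity) (by nlinarith)
        rw [← mul_assoc, div_mul_cancel₀ _ hpi.ne'] at this
        exact le_trans (by linarith) (this.trans (le_abs_self _))
      refine ⟨?_, hθ.trans_le h1⟩
      have := one_div_le_one_div_of_le hθ h1
      linarith
    · have h1 : 1 - t ≤ |Real.sin (Real.pi * t)| := by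
        have := Real.mul_le_sin (x := Real.pi * (1 - t)) (by nlinarith) (by nlinarith)
        rw [← mul_assoc, div_mul_cancel₀ _ hpi.ne', mul_one_sub Real.pi t, Real.sin_pi_sub] at this
        exact le_trans (by linarith) (this.trans (le_abs_self _))
      have h2 : 0 < 1 - t := by linarith
      refine ⟨?_, h2.trans_le h1⟩
      have := one_div_le_one_div_of_le h2 h1
      linarith
  rw [hneg]
  refine le_trans ?_ hsin.1
  set z := Complex.exp (Complex.I * (2 * Real.pi * θ : ℝ)) with hz
  have hsum : ∑ n ∈ range N, Complex.exp (2 * Real.pi * Complex.I * (n * θ : ℝ)) =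
      ∑ n ∈ range N, z ^ n := by
    refine sum_congr rfl fun n _ => ?_
    rw [hz, ← Complex.exp_nat_mul]
    congr 1
    push_cast
    ring
  have hz1 : ‖z - 1‖ = 2 * |Real.sin (Real.pi * θ)| := by
    rw [hz, Complex.norm_exp_I_mul_ofReal_sub_one, Real.norm_eq_abs, abs_mul, abs_two]
    congr 3
    ring
  have hzn : ‖z‖ = 1 := by rw [hz, mul_comm, Complex.norm_exp_ofReal_mul_I]
  have hne : z ≠ 1 := by
    rw [← sub_ne_zero, ← norm_ne_zero_iff, hz1]
    have := abs_pos.mpr hsin.2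
    positivity
  rw [hsum, geom_sum_eq hne, norm_div, hz1]
  have hnum : ‖z ^ N - 1‖ ≤ 2 := by
    refine (norm_sub_le _ _).trans ?_
    rw [norm_pow, hzn]
    norm_num
  have := abs_pos.mpr hsin.2
  rw [div_le_div_iff₀ (by positivity) this]
  nlinarith

/-- Reciprocals of the fractional parts of points that are `1 / M`-separated modulo `1`. -/
theorem sum_one_div_fract_le {ι : Type*} (s : Finset ι) (y : ι → ℝ) (M : ℕ)
    (h0 : ∀ i ∈ s, 1 ≤ M * Int.fract (y i))
    (hsep : ∀ i ∈ s, ∀ j ∈ s, i ≠ j → 1 ≤ M * Int.fract (y i - y j)) :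
    ∑ i ∈ s, 1 / Int.fract (y i) ≤ M * (1 + Real.log M) := by
  classical
  -- Cells of length `1 / M`: separation puts at most one point in each and `h0` keeps cell `0`
  -- empty, so the sum is dominated by `M` times a harmonic sum.
  set k : ι → ℕ := fun i => ⌊M * Int.fract (y i)⌋₊ with hk
  have hM0 : ∀ i ∈ s, (0 : ℝ) < M := fun i hi => by
    rcases M.eq_zero_or_pos with h | h
    · have := h0 i hi
      simp [h] at this
      linarith
    · exact_mod_cast h
  have hk1 : ∀ i ∈ s, 1 ≤ k i := fun i hi => by
    rw [hk, Nat.le_floor_iff' one_ne_zero]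
    exact_mod_cast h0 i hi
  have hle : ∀ i ∈ s, (k i : ℝ) ≤ M * Int.fract (y i) := fun i hi =>
    Nat.floor_le (by linarith [h0 i hi])
  have hkM : ∀ i ∈ s, k i ≤ M := fun i hi => by
    have h1 := Int.fract_lt_one (y i)
    have h2 := hle i hi
    have h3 := hM0 i hi
    have : (k i : ℝ) ≤ M := by nlinarith
    exact_mod_cast this
  have key : ∀ i ∈ s, ∀ j ∈ s, i ≠ j → k i = k j → Int.fract (y j) ≤ Int.fract (y i) → False := by
    intro i hi j hj hij hkij hfr
    have hs := hsep i hi j hj hij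
    have h1 : M * Int.fract (y i) < k i + 1 := Nat.lt_floor_add_one _
    have h2 := hle j hj
    rw [← hkij] at h2
    have hfe : Int.fract (y i - y j) = Int.fract (y i) - Int.fract (y j) := by
      rw [Int.fract_eq_iff]
      refine ⟨by linarith, by linarith [Int.fract_lt_one (y i), Int.fract_nonneg (y j)],
        ⌊y i⌋ - ⌊y j⌋, ?_⟩
      rw [← Int.self_sub_floor, ← Int.self_sub_floor]
      push_cast
      ring
    rw [hfe] at hs
    linarith
  have hinj : Set.InjOn k s := by
    intro i hi j hj hij
    by_contra hne
    rcases le_total (Int.fract (y j)) (Int.fract (y i)) with h | h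
    · exact key i hi j hj hne hij h
    · exact key j hj i hi (Ne.symm hne) hij.symm h
  calc ∑ i ∈ s, 1 / Int.fract (y i) ≤ ∑ i ∈ s, M * (1 / (k i : ℝ)) := by
        refine sum_le_sum fun i hi => ?_
        have h1 : (1 : ℝ) ≤ k i := by exact_mod_cast hk1 i hi
        have h2 := h0 i hi
        have h3 := hM0 i hi
        have h4 : 0 < Int.fract (y i) := by
          by_contra! h
          nlinarith
        rw [mul_one_div, div_le_div_iff₀ h4 (by linarith), one_mul]
        exact hle i hi
    _ = M * ∑ n ∈ s.image k, 1 / (n : ℝ) := by rw [sum_image hinj, mul_sum]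
    _ ≤ M * ∑ n ∈ Icc 1 M, 1 / (n : ℝ) := by
        gcongr
        intro n hn
        obtain ⟨i, hi, rfl⟩ := mem_image.mp hn
        exact mem_Icc.mpr ⟨hk1 i hi, hkM i hi⟩
    _ ≤ M * (1 + Real.log M) := by
        gcongr
        exact sum_Icc_one_div_le M

/-- The large sieve inequality for points that are `1 / M`-separated modulo `1`, with a
logarithmic loss. -/
theorem additive_large_sieve {ι : Type*} (s : Finset ι) (x : ι → ℝ) (M N : ℕ) (hM : 1 ≤ M)
    (hsep : ∀ i ∈ s, ∀ j ∈ s, i ≠ j → 1 ≤ M * Int.fract (x i - x j)) (a : ℕ → ℂ) :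
    ∑ i ∈ s, ‖∑ n ∈ range N, a n * Complex.exp (2 * Real.pi * Complex.I * (n * x i : ℝ))‖ ^ 2 ≤
      (N + 2 * (M * (1 + Real.log M))) * ∑ n ∈ range N, ‖a n‖ ^ 2 := by
  classical
  have hlog : 0 ≤ Real.log M := Real.log_natCast_nonneg M
  refine sum_norm_sq_le_of_gram_row_sum_le s (range N)
    (fun i n => Complex.exp (2 * Real.pi * Complex.I * (n * x i : ℝ))) (by positivity) ?_ a
  intro i hi
  have hterm : ∀ j, ∑ n ∈ range N, Complex.exp (2 * Real.pi * Complex.I * (n * x i : ℝ)) *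
      (starRingEnd ℂ) (Complex.exp (2 * Real.pi * Complex.I * (n * x j : ℝ))) =
      ∑ n ∈ range N, Complex.exp (2 * Real.pi * Complex.I * (n * (x i - x j) : ℝ)) := by
    intro j
    refine sum_congr rfl fun n _ => ?_
    rw [← Complex.exp_conj, ← Complex.exp_add]
    congr 1
    simp only [map_mul, Complex.conj_ofReal, Complex.conj_I, map_ofNat]
    push_cast
    ring
  simp only [hterm]
  -- The diagonal term contributes `N`. Off the diagonal, the differences `x i - x j` and their
  -- negatives are again separated from `0` and from each other.
  rw [← add_sum_erase s _ hi]
  refine add_le_add ?_ ?_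
  · refine (norm_sum_le _ _).trans ?_
    simp
  · have hpos : ∀ j ∈ s.erase i, 0 < Int.fract (x i - x j) := fun j hj => by
      have := hsep i hi j (mem_of_mem_erase hj) (ne_of_mem_erase hj).symm
      by_contra! h
      have h2 : (0 : ℝ) ≤ M := by positivity
      nlinarith
    calc ∑ j ∈ s.erase i, ‖∑ n ∈ range N,
            Complex.exp (2 * Real.pi * Complex.I * (n * (x i - x j) : ℝ))‖
        ≤ ∑ j ∈ s.erase i, (1 / Int.fract (x i - x j) + 1 / Int.fract (-(x i - x j))) :=
          sum_le_sum fun j hj => norm_sum_exp_le N (hpos j hj)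
      _ = ∑ j ∈ s.erase i, 1 / Int.fract (x i - x j) +
            ∑ j ∈ s.erase i, 1 / Int.fract (x j - x i) := by
          simp only [sum_add_distrib, neg_sub]
      _ ≤ M * (1 + Real.log M) + M * (1 + Real.log M) := by
          refine add_le_add (sum_one_div_fract_le _ _ M ?_ ?_) (sum_one_div_fract_le _ _ M ?_ ?_)
          · exact fun j hj => hsep i hi j (mem_of_mem_erase hj) (ne_of_mem_erase hj).symm
          · intro j hj l hl hjl
            rw [sub_sub_sub_cancel_left]
            exact hsep l (mem_of_mem_erase hl) j (mem_of_mem_erase hj) hjl.symm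
          · exact fun j hj => hsep j (mem_of_mem_erase hj) i hi (ne_of_mem_erase hj)
          · intro j hj l hl hjl
            rw [sub_sub_sub_cancel_right]
            exact hsep j (mem_of_mem_erase hj) l (mem_of_mem_erase hl) hjl
      _ = 2 * (M * (1 + Real.log M)) := by ring

/-- The Farey fractions `b / q` with `1 ≤ q ≤ Q`, indexed by the pairs `(q, b)`. -/
def fareyIndex (Q : ℕ) : Finset (Σ _ : ℕ, ℕ) :=
  (Icc 1 Q).sigma fun q => {b ∈ range q | b.Coprime q}

/-- Multiplying the fractional part by `q r ≤ Q²` gives an integer, so it suffices that it is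
nonzero. -/
theorem fareyIndex_separated (Q : ℕ) {i j : Σ _ : ℕ, ℕ} (hi : i ∈ fareyIndex Q)
    (hj : j ∈ fareyIndex Q) (hij : i ≠ j) :
    1 ≤ ((Q ^ 2 : ℕ) : ℝ) * Int.fract ((i.2 : ℝ) / i.1 - (j.2 : ℝ) / j.1) := by
  obtain ⟨q, b⟩ := i
  obtain ⟨r, c⟩ := j
  simp only [fareyIndex, mem_sigma, mem_Icc, mem_filter, mem_range] at hi hj
  obtain ⟨⟨hq1, hqQ⟩, hbq, hb⟩ := hi
  obtain ⟨⟨hr1, hrQ⟩, hcr, hc⟩ := hj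
  have hq : (0 : ℝ) < q := by exact_mod_cast hq1
  have hr : (0 : ℝ) < r := by exact_mod_cast hr1
  simp only
  set θ : ℝ := (b : ℝ) / q - (c : ℝ) / r with hθ
  have hint : (q * r : ℝ) * Int.fract θ = ((b * r - c * q - ⌊θ⌋ * (q * r) : ℤ) : ℝ) := by
    rw [← Int.self_sub_floor]
    push_cast
    rw [mul_sub, hθ]
    field_simp
  -- Both fractions lie in `[0, 1)`, so an integral difference vanishes; in lowest terms, equal
  -- fractions have equal numerators and denominators.
  have hne : Int.fract θ ≠ 0 := by
    intro h0
    have h1 : (b : ℝ) / q < 1 := (div_lt_one hq).mpr (by exact_mod_cast hbq)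
    have h2 : (c : ℝ) / r < 1 := (div_lt_one hr).mpr (by exact_mod_cast hcr)
    have h3 : (0 : ℝ) ≤ (b : ℝ) / q := by positivity
    have h4 : (0 : ℝ) ≤ (c : ℝ) / r := by positivity
    have h5 : ((⌊θ⌋ : ℤ) : ℝ) = θ := by
      have := Int.self_sub_floor θ
      linarith
    have h6 : ⌊θ⌋ = 0 := by
      have l1 : ((⌊θ⌋ : ℤ) : ℝ) < 1 := by rw [h5]; linarith
      have l2 : (-1 : ℝ) < ((⌊θ⌋ : ℤ) : ℝ) := by rw [h5]; linarith
      have l1' : ⌊θ⌋ < 1 := by exact_mod_cast l1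
      have l2' : -1 < ⌊θ⌋ := by exact_mod_cast l2
      omega
    have h7 : (b : ℝ) / q = (c : ℝ) / r := by
      rw [h6] at h5
      push_cast at h5
      linarith
    rw [div_eq_div_iff hq.ne' hr.ne'] at h7
    have h8 : b * r = c * q := by exact_mod_cast h7
    have h9 : q ∣ r := hb.symm.dvd_of_dvd_mul_left (h8 ▸ dvd_mul_left q c)
    have h10 : r ∣ q := hc.symm.dvd_of_dvd_mul_left (h8 ▸ dvd_mul_left r b)
    have h11 : q = r := Nat.dvd_antisymm h9 h10
    subst h11
    have h12 : b = c := Nat.eq_of_mul_eq_mul_right hq1 h8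
    exact hij (by rw [h12])
  have hpos : 0 < Int.fract θ := lt_of_le_of_ne (Int.fract_nonneg θ) hne.symm
  have h1 : (1 : ℝ) ≤ (q * r : ℝ) * Int.fract θ := by
    have hp : 0 < (q * r : ℝ) * Int.fract θ := by positivity
    rw [hint] at hp ⊢
    exact_mod_cast Int.cast_pos.mp hp
  have h2 : (q * r : ℝ) ≤ ((Q ^ 2 : ℕ) : ℝ) := by
    have : q * r ≤ Q ^ 2 := by rw [sq]; exact Nat.mul_le_mul hqQ hrQ
    exact_mod_cast this
  exact h1.trans (by gcongr)

theorem farey_large_sieve (Q N : ℕ) (hQ : 1 ≤ Q) (a : ℕ → ℂ) :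
    ∑ q ∈ Icc 1 Q, ∑ b ∈ range q with b.Coprime q,
      ‖∑ n ∈ range N, a n * Complex.exp (2 * Real.pi * Complex.I * (n * (b / q) : ℝ))‖ ^ 2 ≤
      (N + 2 * ((Q ^ 2 : ℕ) * (1 + Real.log (Q ^ 2 : ℕ)))) * ∑ n ∈ range N, ‖a n‖ ^ 2 := by
  rw [sum_sigma']
  exact additive_large_sieve (fareyIndex Q) (fun i => (i.2 : ℝ) / i.1) (Q ^ 2) N
    (Nat.one_le_pow _ _ hQ) (fun i hi j hj hij => fareyIndex_separated Q hi hj hij) a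

/-! ### Parseval for characters, Gauss sums and the multiplicative large sieve -/

theorem ZMod.sum_range_natCast {M : Type*} [AddCommMonoid M] (q : ℕ) [NeZero q] (g : ZMod q → M) :
    ∑ n ∈ range q, g (n : ZMod q) = ∑ a : ZMod q, g a := by
  refine sum_bij' (fun n _ => (n : ZMod q)) (fun a _ => a.val) (fun _ _ => mem_univ _)
    (fun a _ => mem_range.mpr a.val_lt) (fun n hn => ZMod.val_cast_of_lt (mem_range.mp hn))
    (fun a _ => ZMod.natCast_zmod_val a) (fun _ _ => rfl)

/-- Parseval's identity for an orthogonal system. -/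
theorem sum_norm_sq_eq_of_orthogonal {ι κ : Type*} [DecidableEq κ] (s : Finset ι) (t : Finset κ)
    (K : ι → κ → ℂ) (w : κ → ℝ)
    (horth : ∀ b ∈ t, ∀ c ∈ t, ∑ i ∈ s, K i b * conj (K i c) = if b = c then (w b : ℂ) else 0)
    (f : κ → ℂ) :
    ∑ i ∈ s, ‖∑ b ∈ t, K i b * f b‖ ^ 2 = ∑ b ∈ t, w b * ‖f b‖ ^ 2 := by
  rw [← Complex.ofReal_inj]
  push_cast
  simp only [← Complex.mul_conj', map_sum, map_mul, sum_mul_sum]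
  rw [sum_comm]
  refine sum_congr rfl fun b hb => ?_
  rw [sum_comm]
  calc ∑ c ∈ t, ∑ i ∈ s, K i b * f b * (conj (K i c) * conj (f c))
      = ∑ c ∈ t, (if b = c then (w b : ℂ) else 0) * (f b * conj (f c)) := by
        refine sum_congr rfl fun c hc => ?_
        rw [← horth b hb c hc, sum_mul]
        exact sum_congr rfl fun i _ => by ring
    _ = w b * (f b * conj (f b)) := by
        simp [ite_mul, hb]

namespace DirichletCharacter

theorem sum_mul_conj {q : ℕ} [NeZero q] (b c : ZMod q) :
    ∑ χ : DirichletCharacter ℂ q, χ b * conj (χ c) =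
      if b = c then (((if IsUnit b then (q.totient : ℝ) else 0) : ℝ) : ℂ) else 0 := by
  by_cases hc : IsUnit c
  · have hinv : ∀ χ : DirichletCharacter ℂ q, conj (χ c) = χ c⁻¹ := by
      intro χ
      have h1 : conj (χ c) * χ c = 1 := by
        have := MulChar.star_apply' χ c
        rw [RCLike.star_def] at this
        rw [this, ← MulChar.mul_apply, inv_mul_cancel, MulChar.one_apply hc]
      have h2 : χ c⁻¹ * χ c = 1 := by
        rw [← map_mul, ZMod.inv_mul_of_unit c hc, map_one]
      exact mul_right_cancel₀ (right_ne_zero_of_mul_eq_one h1) (h1.trans h2.symm)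
    simp only [hinv]
    rw [sum_congr rfl fun χ _ => mul_comm (χ b) (χ c⁻¹), sum_char_inv_mul_char_eq ℂ hc b]
    by_cases hbc : c = b
    · subst hbc; simp [hc]
    · simp [hbc, Ne.symm hbc]
  · rw [sum_eq_zero fun χ _ => by rw [MulChar.map_nonunit χ hc, map_zero, mul_zero]]
    by_cases hbc : b = c
    · subst hbc; simp [hc]
    · simp [hbc]

theorem sum_norm_sq_sum_mul {q : ℕ} [NeZero q] (f : ZMod q → ℂ) :
    ∑ χ : DirichletCharacter ℂ q, ‖∑ b, χ b * f b‖ ^ 2 =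
      ∑ b : ZMod q, (if IsUnit b then (q.totient : ℝ) else 0) * ‖f b‖ ^ 2 :=
  sum_norm_sq_eq_of_orthogonal univ univ (fun (χ : DirichletCharacter ℂ q) b => χ b) _
    (fun b _ c _ => sum_mul_conj b c) f

/-- For primitive `χ` the additive Fourier transform of `χ` at `a` is `conj (χ a)` times the Gauss
sum. Parseval then compares two multiples of the nonzero number `∑ ‖χ a‖²`. -/
theorem norm_gaussSum_sq {q : ℕ} [NeZero q] {χ : DirichletCharacter ℂ q} (hχ : χ.IsPrimitive) :
    ‖gaussSum χ ZMod.stdAddChar‖ ^ 2 = q := by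
  have horth : ∀ b c : ZMod q, ∑ a : ZMod q, ZMod.stdAddChar (a * b) *
      conj (ZMod.stdAddChar (a * c)) = if b = c then (((q : ℝ)) : ℂ) else 0 := by
    intro b c
    calc ∑ a : ZMod q, ZMod.stdAddChar (a * b) * conj (ZMod.stdAddChar (a * c))
        = ∑ a : ZMod q, (ZMod.stdAddChar (a * (b - c)) : ℂ) := by
          refine sum_congr rfl fun a _ => ?_
          rw [← AddChar.map_neg_eq_conj, ← AddChar.map_add_eq_mul]
          congr 1; ring
      _ = _ := by
          rw [AddChar.sum_mulShift _ (ZMod.isPrimitive_stdAddChar q)]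
          simp [sub_eq_zero]
  have hpars := sum_norm_sq_eq_of_orthogonal univ univ
    (fun a b : ZMod q => (ZMod.stdAddChar (a * b) : ℂ)) (fun _ => (q : ℝ))
    (fun b _ c _ => horth b c) (fun b => χ b)
  have hleft : ∀ a : ZMod q, ‖∑ b, (ZMod.stdAddChar (a * b) : ℂ) * χ b‖ ^ 2 =
      ‖χ a‖ ^ 2 * ‖gaussSum χ ZMod.stdAddChar‖ ^ 2 := by
    intro a
    have h := gaussSum_mulShift_of_isPrimitive (ZMod.stdAddChar (N := q)) hχ a
    have h2 : ∑ b, (ZMod.stdAddChar (a * b) : ℂ) * χ b =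
        gaussSum χ ((ZMod.stdAddChar (N := q)).mulShift a) := by
      simp only [gaussSum, AddChar.mulShift_apply]
      exact sum_congr rfl fun b _ => mul_comm _ _
    rw [h2, h, norm_mul, mul_pow, ← MulChar.star_apply', norm_star]
  simp only [hleft] at hpars
  rw [← sum_mul, ← mul_sum, mul_comm] at hpars
  refine mul_right_cancel₀ (ne_of_gt ?_) hpars
  refine sum_pos' (fun _ _ => by positivity) ⟨1, mem_univ _, ?_⟩
  simp

open scoped Classical in
-- The Gauss sum of `χ⁻¹`, of squared norm `q`, expresses `χ n` through additive characters.
-- Positivity then permits extending the sum to all characters, where Parseval applies and retains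
-- only the units `b`.
theorem sum_primitive_norm_sq_le {q : ℕ} [NeZero q] (N : ℕ) (a : ℕ → ℂ) :
    q * ∑ χ : DirichletCharacter ℂ q with χ.IsPrimitive, ‖∑ n ∈ range N, a n * χ n‖ ^ 2 ≤
      q.totient * ∑ b ∈ range q with b.Coprime q,
        ‖∑ n ∈ range N, a n * Complex.exp (2 * Real.pi * Complex.I * (n * (b / q) : ℝ))‖ ^ 2 := by
  set S : ZMod q → ℂ := fun b => ∑ n ∈ range N, a n * ZMod.stdAddChar ((n : ZMod q) * b) with hS
  have hprim : ∀ χ : DirichletCharacter ℂ q, χ.IsPrimitive →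
      q * ‖∑ n ∈ range N, a n * χ n‖ ^ 2 = ‖∑ b, χ⁻¹ b * S b‖ ^ 2 := by
    intro χ hχ
    have hχ' : χ⁻¹.IsPrimitive := by rw [isPrimitive_def, conductor_inv]; exact hχ
    have hsum : ∑ b, χ⁻¹ b * S b =
        gaussSum χ⁻¹ ZMod.stdAddChar * ∑ n ∈ range N, a n * χ n := by
      simp only [hS, mul_sum]
      rw [sum_comm]
      refine sum_congr rfl fun n _ => ?_
      have h := gaussSum_mulShift_of_isPrimitive (ZMod.stdAddChar (N := q)) hχ' n
      rw [inv_inv] at h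
      rw [mul_left_comm, mul_comm (gaussSum _ _), ← h, gaussSum, mul_sum]
      refine sum_congr rfl fun b _ => ?_
      rw [AddChar.mulShift_apply]
      ring
    rw [hsum, norm_mul, mul_pow, norm_gaussSum_sq hχ']
  have hSval : ∀ b : ℕ, S b =
      ∑ n ∈ range N, a n * Complex.exp (2 * Real.pi * Complex.I * (n * (b / q) : ℝ)) := by
    intro b
    refine sum_congr rfl fun n _ => ?_
    have h := ZMod.stdAddChar_coe (N := q) ((n : ℤ) * b)
    push_cast at h
    rw [h]
    congr 2
    push_cast
    ring
  calc q * ∑ χ : DirichletCharacter ℂ q with χ.IsPrimitive, ‖∑ n ∈ range N, a n * χ n‖ ^ 2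
      = ∑ χ : DirichletCharacter ℂ q with χ.IsPrimitive, ‖∑ b, χ⁻¹ b * S b‖ ^ 2 := by
        rw [mul_sum]
        exact sum_congr rfl fun χ hχ => hprim χ (mem_filter.mp hχ).2
    _ ≤ ∑ χ : DirichletCharacter ℂ q, ‖∑ b, χ⁻¹ b * S b‖ ^ 2 :=
        sum_le_sum_of_subset_of_nonneg (filter_subset _ _) fun _ _ _ => by positivity
    _ = ∑ χ : DirichletCharacter ℂ q, ‖∑ b, χ b * S b‖ ^ 2 :=
        Fintype.sum_equiv (Equiv.inv _) _ _ fun χ => rfl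
    _ = ∑ b : ZMod q, (if IsUnit b then (q.totient : ℝ) else 0) * ‖S b‖ ^ 2 :=
        sum_norm_sq_sum_mul S
    _ = ∑ b ∈ range q, (if IsUnit (b : ZMod q) then (q.totient : ℝ) else 0) * ‖S b‖ ^ 2 :=
        (ZMod.sum_range_natCast q
          fun b => (if IsUnit b then (q.totient : ℝ) else 0) * ‖S b‖ ^ 2).symm
    _ = _ := by
        rw [mul_sum, sum_filter]
        refine sum_congr rfl fun b _ => ?_
        rw [hSval]
        simp only [ZMod.isUnit_iff_coprime, ite_mul, zero_mul]

open scoped Classical in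
/-- The multiplicative large sieve inequality, with a logarithmic loss. -/
theorem large_sieve (Q N : ℕ) (hQ : 1 ≤ Q) (a : ℕ → ℂ) :
    ∑ q ∈ Icc 1 Q, (q / q.totient : ℝ) *
      ∑ χ : DirichletCharacter ℂ q with χ.IsPrimitive, ‖∑ n ∈ range N, a n * χ n‖ ^ 2 ≤
      (N + 2 * ((Q ^ 2 : ℕ) * (1 + Real.log (Q ^ 2 : ℕ)))) * ∑ n ∈ range N, ‖a n‖ ^ 2 := by
  refine le_trans (sum_le_sum fun q hq => ?_) (farey_large_sieve Q N hQ a)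
  have hq1 : 0 < q := (mem_Icc.mp hq).1
  have : NeZero q := ⟨hq1.ne'⟩
  have hφ : (0 : ℝ) < q.totient := by exact_mod_cast Nat.totient_pos.mpr hq1
  rw [div_mul_eq_mul_div, div_le_iff₀ hφ]
  exact (sum_primitive_norm_sq_le N a).trans_eq (mul_comm _ _)

/-! ### Mean squares of character sums over intervals -/

theorem sum_range_shift_eq_mod {q : ℕ} [NeZero q] {χ : DirichletCharacter ℂ q} (hχ : χ ≠ 1)
    (V : ℕ) :
    ∑ n ∈ range V, χ ((n : ZMod q) + 1) = ∑ n ∈ range (V % q), χ ((n : ZMod q) + 1) := by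
  have hper : ∑ n ∈ range q, χ ((n : ZMod q) + 1) = 0 := by
    rw [ZMod.sum_range_natCast q fun a => χ (a + 1),
      Fintype.sum_equiv (Equiv.addRight 1) (fun a => χ (a + 1)) (fun a => χ a) fun _ => rfl]
    exact MulChar.sum_eq_zero_of_ne_one hχ
  have hmul : ∀ k r : ℕ, ∑ n ∈ range (q * k + r), χ ((n : ZMod q) + 1) =
      ∑ n ∈ range r, χ ((n : ZMod q) + 1) := by
    intro k r
    induction k with
    | zero => simp
    | succ k ih =>
      rw [show q * (k + 1) + r = q + (q * k + r) by ring, sum_range_add, hper, zero_add, ← ih]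
      simp
  conv_lhs => rw [← Nat.div_add_mod V q]
  exact hmul _ _

/-- Full periods cancel for `χ ≠ 1`, leaving a sum over `V % q` distinct residues; Parseval over all
characters gives at most `φ(q) (V % q)`. -/
theorem sum_ne_one_norm_sq_sum_Icc_le {q : ℕ} [NeZero q] (V : ℕ) :
    ∑ χ : DirichletCharacter ℂ q with χ ≠ 1, ‖∑ n ∈ Icc 1 V, χ n‖ ^ 2 ≤ q * V := by
  classical
  -- The indicator of the residues `1, …, V % q`; the shift by `1` matches intervals that start at
  -- `1`.
  set f : ZMod q → ℂ := fun b => if (b - 1).val < V % q then 1 else 0 with hf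
  have hlt : V % q < q := Nat.mod_lt _ (NeZero.pos q)
  have hsum : ∀ {M : Type} [AddCommMonoid M] (g : ZMod q → M),
      ∑ b : ZMod q, (if (b - 1).val < V % q then g b else 0) =
        ∑ n ∈ range (V % q), g ((n : ZMod q) + 1) := by
    intro M _ g
    rw [← Fintype.sum_equiv (Equiv.addRight 1)
      (fun a : ZMod q => if a.val < V % q then g (a + 1) else 0) _ (fun a => by simp),
      ← ZMod.sum_range_natCast q, ← sum_filter]
    · refine sum_congr ?_ fun _ _ => rfl
      ext n
      simp only [mem_filter, mem_range]
      constructor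
      · rintro ⟨h1, h2⟩
        rwa [ZMod.val_cast_of_lt h1] at h2
      · intro h
        exact ⟨h.trans hlt, by rwa [ZMod.val_cast_of_lt (h.trans hlt)]⟩
  have hchar : ∀ χ : DirichletCharacter ℂ q, χ ≠ 1 → ∑ n ∈ Icc 1 V, χ n = ∑ b, χ b * f b := by
    intro χ hχ
    have h1 : ∑ n ∈ Icc 1 V, χ n = ∑ n ∈ range V, χ ((n : ZMod q) + 1) := by
      rw [← Ico_add_one_right_eq_Icc, sum_Ico_eq_sum_range]
      refine sum_congr (by simp) fun n _ => ?_
      push_cast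
      rw [add_comm]
    rw [h1, sum_range_shift_eq_mod hχ, ← hsum fun b => χ b]
    simp [hf]
  calc ∑ χ : DirichletCharacter ℂ q with χ ≠ 1, ‖∑ n ∈ Icc 1 V, χ n‖ ^ 2
      = ∑ χ : DirichletCharacter ℂ q with χ ≠ 1, ‖∑ b, χ b * f b‖ ^ 2 :=
        sum_congr rfl fun χ hχ => by rw [hchar χ (mem_filter.mp hχ).2]
    _ ≤ ∑ χ : DirichletCharacter ℂ q, ‖∑ b, χ b * f b‖ ^ 2 :=
        sum_le_sum_of_subset_of_nonneg (filter_subset _ _) fun _ _ _ => by positivity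
    _ = ∑ b : ZMod q, (if IsUnit b then (q.totient : ℝ) else 0) * ‖f b‖ ^ 2 :=
        sum_norm_sq_sum_mul f
    _ ≤ ∑ b : ZMod q, if (b - 1).val < V % q then (q : ℝ) else 0 := by
        refine sum_le_sum fun b _ => ?_
        have h1 : (q.totient : ℝ) ≤ q := by exact_mod_cast Nat.totient_le q
        have h2 : (0 : ℝ) ≤ q := by positivity
        by_cases h : (b - 1).val < V % q
        · simp only [hf, h, if_true, norm_one, one_pow, mul_one]
          split_ifs <;> assumption
        · simp [hf, h]
    _ = (V % q : ℕ) * (q : ℝ) := by rw [hsum fun _ => (q : ℝ)]; simp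
    _ ≤ q * V := by
        rw [mul_comm]
        gcongr
        exact_mod_cast Nat.mod_le V q

end DirichletCharacter

/-! ### Reduction to primitive characters and the two mean-square bounds -/

theorem sum_Icc_filter_dvd {M : Type*} [AddCommMonoid M] {d : ℕ} (hd : 0 < d) (W : ℕ)
    (f : ℕ → M) : ∑ w ∈ Icc 1 W with d ∣ w, f w = ∑ v ∈ Icc 1 (W / d), f (d * v) := by
  refine sum_bij' (fun w _ => w / d) (fun v _ => d * v) ?_ ?_ ?_ ?_ ?_
  · intro w hw
    obtain ⟨hw, k, rfl⟩ := mem_filter.mp hw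
    have h := mem_Icc.mp hw
    rw [Nat.mul_div_cancel_left _ hd, mem_Icc, Nat.le_div_iff_mul_le hd, mul_comm k]
    exact ⟨Nat.pos_of_mul_pos_left h.1, h.2⟩
  · intro v hv
    have h := mem_Icc.mp hv
    rw [Nat.le_div_iff_mul_le hd, mul_comm v] at h
    exact mem_filter.mpr ⟨mem_Icc.mpr ⟨Nat.mul_pos hd h.1, h.2⟩, dvd_mul_right _ _⟩
  · intro w hw
    exact Nat.mul_div_cancel' (mem_filter.mp hw).2
  · intro v _
    exact Nat.mul_div_cancel_left _ hd
  · intro w hw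
    rw [Nat.mul_div_cancel' (mem_filter.mp hw).2]

theorem sum_divisors_filter_dvd_moebius {a : ℕ} (ha : a ≠ 0) (w : ℕ) :
    ∑ d ∈ a.divisors with d ∣ w, ArithmeticFunction.moebius d = if w.Coprime a then 1 else 0 := by
  have h1 : {d ∈ a.divisors | d ∣ w} = (w.gcd a).divisors := by
    ext d
    simp only [mem_filter, Nat.mem_divisors, Nat.dvd_gcd_iff]
    have : w.gcd a ≠ 0 := Nat.gcd_ne_zero_right ha
    tauto
  rw [h1, ← ArithmeticFunction.coe_zeta_mul_apply, ArithmeticFunction.coe_zeta_mul_moebius,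
    ArithmeticFunction.one_apply]

namespace DirichletCharacter

theorem changeLevel_natCast {q a : ℕ} (h : q ∣ a) (ψ : DirichletCharacter ℂ q) (n : ℕ) :
    changeLevel h ψ n = if n.Coprime a then ψ n else 0 := by
  split_ifs with hn
  · have := changeLevel_eq_cast_of_dvd' ψ h (a := n) (Nat.isCoprime_iff_coprime.mpr hn)
    simpa using this
  · exact MulChar.map_nonunit _ (by rwa [ZMod.isUnit_iff_coprime])

/-- Raising the level only imposes coprimality to `a`, which Möbius inversion removes. -/
theorem sum_Icc_changeLevel {q a : ℕ} (ha : a ≠ 0) (h : q ∣ a) (ψ : DirichletCharacter ℂ q)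
    (W : ℕ) :
    ∑ w ∈ Icc 1 W, changeLevel h ψ w = ∑ d ∈ a.divisors,
      (ArithmeticFunction.moebius d : ℂ) * ψ d * ∑ v ∈ Icc 1 (W / d), ψ v := by
  calc ∑ w ∈ Icc 1 W, changeLevel h ψ w
      = ∑ w ∈ Icc 1 W, ∑ d ∈ a.divisors,
          if d ∣ w then (ArithmeticFunction.moebius d : ℂ) * ψ w else 0 := by
        refine sum_congr rfl fun w _ => ?_
        rw [← sum_filter, ← sum_mul, ← Int.cast_sum, sum_divisors_filter_dvd_moebius ha,
          changeLevel_natCast]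
        split_ifs <;> simp
    _ = _ := by
        rw [sum_comm]
        refine sum_congr rfl fun d hd => ?_
        rw [← sum_filter, sum_Icc_filter_dvd (Nat.pos_of_mem_divisors hd), mul_sum]
        refine sum_congr rfl fun v _ => ?_
        push_cast
        rw [map_mul, mul_assoc]

theorem norm_sq_sum_Icc_changeLevel_le {q a : ℕ} (ha : a ≠ 0) (h : q ∣ a)
    (ψ : DirichletCharacter ℂ q) (W : ℕ) :
    ‖∑ w ∈ Icc 1 W, changeLevel h ψ w‖ ^ 2 ≤
      #a.divisors * ∑ d ∈ a.divisors, ‖∑ v ∈ Icc 1 (W / d), ψ v‖ ^ 2 := by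
  rw [sum_Icc_changeLevel ha h]
  calc _ ≤ (∑ d ∈ a.divisors, ‖∑ v ∈ Icc 1 (W / d), ψ v‖) ^ 2 := by
        gcongr
        refine (norm_sum_le _ _).trans (sum_le_sum fun d _ => ?_)
        rw [norm_mul, norm_mul]
        have h1 : ‖(ArithmeticFunction.moebius d : ℂ)‖ ≤ 1 := by
          rw [Complex.norm_intCast]
          exact_mod_cast ArithmeticFunction.abs_moebius_le_one
        have h2 : ‖ψ d‖ ≤ 1 := norm_le_one ψ _
        exact mul_le_of_le_one_left (norm_nonneg _) (mul_le_one₀ h1 (norm_nonneg _) h2)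
    _ ≤ _ := sq_sum_le_card_mul_sum_sq

open scoped Classical in
/-- Sums over characters modulo `a` are dominated by sums over the primitive characters whose
level divides `a`. -/
theorem sum_le_sum_primitive {a : ℕ} [NeZero a] (g : DirichletCharacter ℂ a → ℝ)
    (G : (q : ℕ) → DirichletCharacter ℂ q → ℝ) (hG0 : ∀ q ψ, 0 ≤ G q ψ)
    (hG : ∀ (q : ℕ) (h : q ∣ a) (ψ : DirichletCharacter ℂ q), ψ.IsPrimitive →
      g (changeLevel h ψ) ≤ G q ψ) :
    ∑ χ, g χ ≤ ∑ q ∈ a.divisors, ∑ ψ : DirichletCharacter ℂ q with ψ.IsPrimitive, G q ψ := by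
  set prim : DirichletCharacter ℂ a → (Σ q : ℕ, DirichletCharacter ℂ q) :=
    fun χ => ⟨χ.conductor, χ.primitiveCharacter⟩ with hprim
  -- Raising the primitive character back to level `a` recovers `χ`. The default `1` is never
  -- reached on the image, since conductors divide `a`.
  have hinj : Function.Injective prim := by
    refine Function.LeftInverse.injective
      (g := fun p => if h : p.1 ∣ a then changeLevel h p.2 else 1) fun χ => ?_
    simp only [hprim, conductor_dvd_level χ, dite_true]
    exact changeLevel_primitiveCharacter χ
  rw [sum_sigma']
  calc ∑ χ, g χ ≤ ∑ χ, G (prim χ).1 (prim χ).2 := by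
        refine sum_le_sum fun χ _ => ?_
        have := hG χ.conductor (conductor_dvd_level χ) χ.primitiveCharacter
          (primitiveCharacter_isPrimitive χ)
        rwa [changeLevel_primitiveCharacter] at this
    _ = ∑ p ∈ univ.image prim, G p.1 p.2 := by rw [sum_image fun _ _ _ _ h => hinj h]
    _ ≤ _ := by
        refine sum_le_sum_of_subset_of_nonneg ?_ fun _ _ _ => hG0 _ _
        intro p hp
        obtain ⟨χ, -, rfl⟩ := mem_image.mp hp
        simp only [hprim, mem_sigma, Nat.mem_divisors, mem_filter, mem_univ, true_and]
        exact ⟨⟨conductor_dvd_level χ, NeZero.ne a⟩, primitiveCharacter_isPrimitive χ⟩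

theorem conductor_changeLevel_of_isPrimitive {q a : ℕ} [NeZero a] (h : q ∣ a)
    {ψ : DirichletCharacter ℂ q} (hψ : ψ.IsPrimitive) : (changeLevel h ψ).conductor = q := by
  rw [conductor_changeLevel, hψ]

/-- Dividing by the conductor `q` cancels the factor `q` in `sum_ne_one_norm_sq_sum_Icc_le`. The
three divisor counts come from Cauchy-Schwarz in the Möbius sum, the sum over `d`, and the sum over
`q ∣ a`. -/
theorem sum_ne_one_norm_sq_sum_Icc_div_conductor_le {a : ℕ} [NeZero a] (W : ℕ) :
    ∑ χ : DirichletCharacter ℂ a with χ ≠ 1, ‖∑ w ∈ Icc 1 W, χ w‖ ^ 2 / χ.conductor ≤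
      (#a.divisors : ℝ) ^ 3 * W := by
  classical
  rw [sum_filter]
  refine (sum_le_sum_primitive _ (fun q ψ => if ψ ≠ 1 then
    (#a.divisors * ∑ d ∈ a.divisors, ‖∑ v ∈ Icc 1 (W / d), ψ v‖ ^ 2) / q else 0) ?_ ?_).trans ?_
  · intro q ψ
    split_ifs <;> positivity
  · intro q h ψ hψ
    simp only [ne_eq, changeLevel_eq_one_iff h, conductor_changeLevel_of_isPrimitive h hψ]
    split_ifs
    · exact le_rfl
    · gcongr
      exact norm_sq_sum_Icc_changeLevel_le (NeZero.ne a) h ψ W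
  · refine (sum_le_sum (g := fun _ => (#a.divisors : ℝ) ^ 2 * W) fun q hq => ?_).trans_eq ?_
    · have hq0 : 0 < q := Nat.pos_of_mem_divisors hq
      have : NeZero q := ⟨hq0.ne'⟩
      have hq1 : (0 : ℝ) < q := by exact_mod_cast hq0
      refine (sum_le_sum_of_subset_of_nonneg (filter_subset _ _) fun _ _ _ => by
        split_ifs <;> positivity).trans ?_
      calc _ = #a.divisors / q * ∑ d ∈ a.divisors, ∑ ψ : DirichletCharacter ℂ q with ψ ≠ 1,
              ‖∑ v ∈ Icc 1 (W / d), ψ v‖ ^ 2 := by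
            rw [sum_comm, mul_sum, sum_filter]
            refine sum_congr rfl fun ψ _ => ?_
            split_ifs
            · ring
            · simp
        _ ≤ #a.divisors / q * ∑ d ∈ a.divisors, (q * W : ℝ) := by
            gcongr with d hd
            refine (sum_ne_one_norm_sq_sum_Icc_le (W / d)).trans ?_
            gcongr
            exact Nat.div_le_self _ _
        _ = (#a.divisors : ℝ) ^ 2 * W := by
            rw [sum_const, nsmul_eq_mul]
            field_simp
    · rw [sum_const, nsmul_eq_mul]
      ring

open scoped Classical in
-- With `a = q r`, a character `ψ` modulo `q` already vanishes off the integers coprime to `q`, so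
-- only coprimality to `r` is imposed. The coefficients thus depend on `r` alone, as the large sieve
-- over `q` requires.
theorem sum_conductor_mul_norm_sq_le {a : ℕ} [NeZero a] (C : Finset ℕ) {N : ℕ}
    (hC : C ⊆ range N) :
    ∑ χ : DirichletCharacter ℂ a, χ.conductor * ‖∑ c ∈ C, χ c‖ ^ 2 ≤
      ∑ p ∈ a.divisorsAntidiagonal, p.1 *
        ∑ ψ : DirichletCharacter ℂ p.1 with ψ.IsPrimitive,
          ‖∑ n ∈ range N, (if n ∈ C ∧ n.Coprime p.2 then 1 else 0) * ψ n‖ ^ 2 := by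
  have hsum : ∀ (q r : ℕ) (ψ : DirichletCharacter ℂ q),
      ∑ n ∈ range N, (if n ∈ C ∧ n.Coprime r then 1 else 0) * ψ n =
        ∑ c ∈ C, if c.Coprime r then ψ c else 0 := by
    intro q r ψ
    rw [← sum_subset hC fun n _ hn => by simp [hn]]
    refine sum_congr rfl fun c hc => ?_
    simp [hc]
  rw [Nat.sum_divisorsAntidiagonal (fun q r => (q : ℝ) *
        ∑ ψ : DirichletCharacter ℂ q with ψ.IsPrimitive,
          ‖∑ n ∈ range N, (if n ∈ C ∧ n.Coprime r then 1 else 0) * ψ n‖ ^ 2)]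
  simp only [mul_sum]
  refine sum_le_sum_primitive _ (fun q ψ => (q : ℝ) *
    ‖∑ n ∈ range N, (if n ∈ C ∧ n.Coprime (a / q) then 1 else 0) * ψ n‖ ^ 2)
    (fun _ _ => by positivity) ?_
  intro q h ψ hψ
  rw [conductor_changeLevel_of_isPrimitive h hψ, hsum]
  refine le_of_eq ?_
  congr 3
  refine sum_congr rfl fun c _ => ?_
  rw [changeLevel_natCast]
  obtain ⟨r, rfl⟩ := h
  have hq : 0 < q := Nat.pos_of_ne_zero fun h0 => NeZero.ne (q * r) (by simp [h0])
  rw [Nat.mul_div_cancel_left _ hq]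
  by_cases hcq : c.Coprime q
  · have hiff : c.Coprime (q * r) ↔ c.Coprime r := by
      rw [Nat.coprime_mul_iff_right, and_iff_right hcq]
    by_cases hr : c.Coprime r
    · rw [if_pos hr, if_pos (hiff.mpr hr)]
    · rw [if_neg hr, if_neg (hiff.not.mpr hr)]
  · rw [MulChar.map_nonunit ψ (by rwa [ZMod.isUnit_iff_coprime])]
    simp

/-- By `φ(q) φ(r) ≤ φ(q r)`, the weight `q / φ(a)` splits into `1/φ(r)` and the large sieve weight
`q/φ(q)`; the large sieve is applied for each fixed `r`. -/
theorem sum_totient_inv_mul_conductor_le (A C : Finset ℕ) {M N : ℕ} (hM : 1 ≤ M)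
    (hA : ∀ a ∈ A, a ≠ 0 ∧ a ≤ M) (hC : C ⊆ range N) :
    ∑ a ∈ A, 1 / (a.totient : ℝ) *
        ∑ χ : DirichletCharacter ℂ a, χ.conductor * ‖∑ c ∈ C, χ c‖ ^ 2 ≤
      (∑ r ∈ Icc 1 M, 1 / (r.totient : ℝ)) *
        ((N + 2 * ((M ^ 2 : ℕ) * (1 + Real.log (M ^ 2 : ℕ)))) * #C) := by
  classical
  set P : ℕ → ℕ → ℝ := fun q r => ∑ ψ : DirichletCharacter ℂ q with ψ.IsPrimitive,
    ‖∑ n ∈ range N, (if n ∈ C ∧ n.Coprime r then 1 else 0) * ψ n‖ ^ 2 with hP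
  have hP0 : ∀ q r, 0 ≤ P q r := fun q r => by positivity
  set G : ℕ × ℕ → ℝ := fun p => 1 / (p.2.totient : ℝ) * (p.1 / p.1.totient * P p.1 p.2) with hG
  have hG0 : ∀ p, 0 ≤ G p := fun p => by have := hP0 p.1 p.2; positivity
  calc ∑ a ∈ A, 1 / (a.totient : ℝ) *
        ∑ χ : DirichletCharacter ℂ a, χ.conductor * ‖∑ c ∈ C, χ c‖ ^ 2
      ≤ ∑ a ∈ A, ∑ p ∈ a.divisorsAntidiagonal, G p := by
        refine sum_le_sum fun a ha => ?_
        have ha0 := (hA a ha).1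
        have : NeZero a := ⟨ha0⟩
        calc _ ≤ 1 / (a.totient : ℝ) * ∑ p ∈ a.divisorsAntidiagonal, p.1 * P p.1 p.2 := by
              gcongr
              exact sum_conductor_mul_norm_sq_le C hC
          _ ≤ _ := by
              rw [mul_sum]
              refine sum_le_sum fun p hp => ?_
              obtain ⟨hpa, -⟩ := Nat.mem_divisorsAntidiagonal.mp hp
              have h1 : 0 < p.1 := Nat.pos_of_ne_zero fun h => ha0 (by rw [← hpa, h, zero_mul])
              have h2 : 0 < p.2 := Nat.pos_of_ne_zero fun h => ha0 (by rw [← hpa, h, mul_zero])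
              have h3 : (0 : ℝ) < p.1.totient := by exact_mod_cast Nat.totient_pos.mpr h1
              have h4 : (0 : ℝ) < p.2.totient := by exact_mod_cast Nat.totient_pos.mpr h2
              have h5 : (p.1.totient * p.2.totient : ℝ) ≤ a.totient := by
                rw [← hpa]
                exact_mod_cast Nat.totient_super_multiplicative p.1 p.2
              calc 1 / (a.totient : ℝ) * (p.1 * P p.1 p.2)
                  ≤ 1 / (p.1.totient * p.2.totient : ℝ) * (p.1 * P p.1 p.2) := by
                    have := hP0 p.1 p.2
                    gcongr
                _ = G p := by
                    rw [hG]
                    field_simp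
    -- A pair `(q, r)` determines `a = q r`, so each pair is counted at most once and may range over
    -- the full square.
    _ = ∑ p ∈ A.biUnion fun a => a.divisorsAntidiagonal, G p := by
        rw [sum_biUnion]
        intro a _ b _ hab
        refine disjoint_left.mpr fun p hpa hpb => hab ?_
        rw [← (Nat.mem_divisorsAntidiagonal.mp hpa).1, (Nat.mem_divisorsAntidiagonal.mp hpb).1]
    _ ≤ ∑ p ∈ Icc 1 M ×ˢ Icc 1 M, G p := by
        refine sum_le_sum_of_subset_of_nonneg ?_ fun _ _ _ => hG0 _
        intro p hp
        obtain ⟨a, ha, hpa⟩ := mem_biUnion.mp hp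
        have h1 := Nat.divisor_le (Nat.fst_mem_divisors_of_mem_antidiagonal hpa)
        have h2 := Nat.divisor_le (Nat.snd_mem_divisors_of_mem_antidiagonal hpa)
        have h3 := Nat.pos_of_mem_divisors (Nat.fst_mem_divisors_of_mem_antidiagonal hpa)
        have h4 := Nat.pos_of_mem_divisors (Nat.snd_mem_divisors_of_mem_antidiagonal hpa)
        have h5 := (hA a ha).2
        rw [mem_product, mem_Icc, mem_Icc]
        exact ⟨⟨h3, h1.trans h5⟩, h4, h2.trans h5⟩
    _ = ∑ r ∈ Icc 1 M, 1 / (r.totient : ℝ) * ∑ q ∈ Icc 1 M, q / q.totient * P q r := by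
        rw [sum_product_right]
        simp only [hG, mul_sum]
    _ ≤ ∑ r ∈ Icc 1 M, 1 / (r.totient : ℝ) *
          ((N + 2 * ((M ^ 2 : ℕ) * (1 + Real.log (M ^ 2 : ℕ)))) * #C) := by
        gcongr with r hr
        refine (large_sieve M N hM fun n => if n ∈ C ∧ n.Coprime r then 1 else 0).trans ?_
        have hlog : 0 ≤ Real.log (M ^ 2 : ℕ) := Real.log_natCast_nonneg _
        gcongr
        calc ∑ n ∈ range N, ‖(if n ∈ C ∧ n.Coprime r then (1 : ℂ) else 0)‖ ^ 2
            ≤ ∑ n ∈ range N, if n ∈ C then (1 : ℝ) else 0 := by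
              refine sum_le_sum fun n _ => ?_
              by_cases h : n ∈ C ∧ n.Coprime r
              · rw [if_pos h, if_pos h.1]
                simp
              · rw [if_neg h]
                split_ifs <;> simp
          _ = #C := by
              rw [← sum_filter, filter_mem_eq_inter, inter_eq_right.mpr hC]
              simp
    _ = _ := by rw [sum_mul]

end DirichletCharacter

/-! ### Character expansion of the error and Cauchy-Schwarz -/

theorem exists_mul_sub_mul_eq_one_iff (a w c : ℕ) :
    (∃ u : ℤ, (c : ℤ) * (w : ℤ) - (a : ℤ) * u = 1) ↔ (c : ZMod a) * (w : ZMod a) = 1 := by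
  have h := ZMod.intCast_eq_intCast_iff_dvd_sub 1 ((c : ℤ) * w) a
  push_cast at h
  rw [eq_comm, h]
  constructor
  · rintro ⟨u, hu⟩
    exact ⟨u, by linarith⟩
  · rintro ⟨u, hu⟩
    exact ⟨u, by linarith⟩

theorem solvableIndicator_eq_sum_characters {a : ℕ} [NeZero a] (w c : ℕ) :
    (solvableIndicator a w c : ℂ) =
      1 / a.totient * ∑ χ : DirichletCharacter ℂ a, χ w * χ c := by
  have hφ : (a.totient : ℂ) ≠ 0 := by
    exact_mod_cast (Nat.totient_pos.mpr (NeZero.pos a)).ne'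
  have h := DirichletCharacter.sum_characters_eq ℂ ((c : ZMod a) * (w : ZMod a))
  simp only [map_mul] at h
  rw [sum_congr rfl fun χ _ => mul_comm _ _, h, solvableIndicator]
  simp only [exists_mul_sub_mul_eq_one_iff]
  split_ifs
  · simp [hφ]
  · simp

theorem sum_one_apply {a : ℕ} [NeZero a] (S : Finset ℕ) :
    ∑ n ∈ S, (1 : DirichletCharacter ℂ a) n = #{n ∈ S | n.Coprime a} := by
  rw [card_filter]
  push_cast
  refine sum_congr rfl fun n _ => ?_
  split_ifs with h
  · exact MulChar.one_apply (by rwa [ZMod.isUnit_iff_coprime])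
  · exact MulChar.map_nonunit _ (by rwa [ZMod.isUnit_iff_coprime])

open scoped Classical in
theorem solutionSum_sub_solutionMainTerm_eq (A C : Finset ℕ) (W : ℕ) (hA : ∀ a ∈ A, a ≠ 0) :
    ((solutionSum A C W - solutionMainTerm A C W : ℝ) : ℂ) =
      ∑ a ∈ A, 1 / a.totient * ∑ χ : DirichletCharacter ℂ a with χ ≠ 1,
        (∑ w ∈ Icc 1 W, χ w) * ∑ c ∈ C, χ c := by
  rw [solutionSum, solutionMainTerm, ← sum_sub_distrib]
  push_cast
  refine sum_congr rfl fun a ha => ?_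
  have : NeZero a := ⟨hA a ha⟩
  have hsum : ∑ w ∈ Icc 1 W, ∑ c ∈ C, (solvableIndicator a w c : ℂ) =
      1 / a.totient * ∑ χ : DirichletCharacter ℂ a, (∑ w ∈ Icc 1 W, χ w) * ∑ c ∈ C, χ c := by
    simp only [solvableIndicator_eq_sum_characters, ← mul_sum]
    congr 1
    simp only [sum_mul_sum]
    rw [sum_congr rfl fun w _ => sum_comm, sum_comm]
  have hone : (#{c ∈ C | c.Coprime a} : ℂ) * #{w ∈ Icc 1 W | w.Coprime a} =
      (∑ w ∈ Icc 1 W, (1 : DirichletCharacter ℂ a) w) *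
        ∑ c ∈ C, (1 : DirichletCharacter ℂ a) c := by
    rw [sum_one_apply, sum_one_apply, mul_comm]
  rw [hsum, mul_assoc, hone, ← mul_sub]
  congr 1
  rw [← sum_filter_add_sum_filter_not univ (fun χ : DirichletCharacter ℂ a => χ ≠ 1)]
  simp [filter_eq']

/-- The Cauchy-Schwarz inequality, weighted by conductors. -/
theorem sq_solutionSum_sub_solutionMainTerm_le (A C : Finset ℕ) (W : ℕ) (hA : ∀ a ∈ A, a ≠ 0) :
    (solutionSum A C W - solutionMainTerm A C W) ^ 2 ≤
      (∑ a ∈ A, 1 / (a.totient : ℝ) * ((#a.divisors : ℝ) ^ 3 * W)) *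
        ∑ a ∈ A, 1 / (a.totient : ℝ) *
          ∑ χ : DirichletCharacter ℂ a, χ.conductor * ‖∑ c ∈ C, χ c‖ ^ 2 := by
  classical
  have hnorm : |solutionSum A C W - solutionMainTerm A C W| ≤
      ∑ a ∈ A, ∑ χ : DirichletCharacter ℂ a with χ ≠ 1,
        1 / (a.totient : ℝ) * (‖∑ w ∈ Icc 1 W, χ w‖ * ‖∑ c ∈ C, χ c‖) := by
    rw [← Real.norm_eq_abs, ← Complex.norm_real, solutionSum_sub_solutionMainTerm_eq A C W hA]
    refine (norm_sum_le _ _).trans (sum_le_sum fun a _ => ?_)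
    rw [norm_mul, ← mul_sum]
    have : ‖(1 / a.totient : ℂ)‖ = 1 / (a.totient : ℝ) := by simp
    rw [this]
    gcongr
    exact (norm_sum_le _ _).trans (sum_le_sum fun χ _ => (norm_mul _ _).le)
  rw [← sq_abs]
  refine (pow_le_pow_left₀ (abs_nonneg _) hnorm 2).trans ?_
  rw [sum_sigma']
  refine (sum_sq_le_sum_mul_sum_of_sq_le_mul _
    (f := fun p : (Σ a : ℕ, DirichletCharacter ℂ a) =>
      1 / (p.1.totient : ℝ) * (‖∑ w ∈ Icc 1 W, p.2 w‖ ^ 2 / p.2.conductor))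
    (g := fun p : (Σ a : ℕ, DirichletCharacter ℂ a) =>
      1 / (p.1.totient : ℝ) * (p.2.conductor * ‖∑ c ∈ C, p.2 c‖ ^ 2))
    (fun _ _ => by positivity) (fun _ _ => by positivity) ?_).trans ?_
  · rintro ⟨a, χ⟩ hp
    have : NeZero a := ⟨hA a (mem_sigma.mp hp).1⟩
    have h0 : (χ.conductor : ℝ) ≠ 0 := by exact_mod_cast χ.conductor_ne_zero
    refine le_of_eq ?_
    simp only
    field_simp
  · rw [← sum_sigma' A (fun a => {χ : DirichletCharacter ℂ a | χ ≠ 1})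
        (fun a χ => 1 / (a.totient : ℝ) * (‖∑ w ∈ Icc 1 W, χ w‖ ^ 2 / χ.conductor)),
      ← sum_sigma' A (fun a => {χ : DirichletCharacter ℂ a | χ ≠ 1})
        (fun a χ => 1 / (a.totient : ℝ) * (χ.conductor * ‖∑ c ∈ C, χ c‖ ^ 2))]
    simp only [← mul_sum]
    refine mul_le_mul (sum_le_sum fun a ha => ?_) (sum_le_sum fun a _ => ?_) (by positivity)
      (by positivity)
    · have : NeZero a := ⟨hA a ha⟩
      gcongr
      refine le_trans (le_of_eq ?_)
        (DirichletCharacter.sum_ne_one_norm_sq_sum_Icc_div_conductor_le (a := a) W)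
      congr!
    · gcongr
      exact filter_subset _ _

/-! ### Choice of parameters and conclusion -/

theorem one_add_log_le_mul_rpow {ε z : ℝ} (hε : 0 < ε) (hz : 1 ≤ z) :
    1 + Real.log z ≤ (1 + 1 / ε) * z ^ ε := by
  have h1 := Real.log_le_rpow_div (zero_le_one.trans hz) hε
  have h2 : 1 ≤ z ^ ε := Real.one_le_rpow hz hε.le
  rw [add_mul, one_mul, one_div_mul_eq_div]
  linarith

theorem theorem4 (η : ℝ) (hη : 0 < η) :
    ∃ K : ℝ, 0 < K ∧
      ∀ (X Z : ℝ) (_hX : 0 < X) (_hZ : 0 < Z) (A C : Finset ℕ) (W : ℕ)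
        (_hC : ∀ c ∈ C, Squarefree c ∧ (c : ℝ) ∈ Set.Icc (X / 2) X)
        (_hA : ∀ a ∈ A, Squarefree a ∧ (a : ℝ) ∈ Set.Icc (Z / 2) Z)
        (_hW : (W : ℝ) ≤ Z),
        |solutionSum A C W - solutionMainTerm A C W| ≤
          K * ((X * Z) ^ η *
            Real.sqrt ((A.card : ℝ) * (C.card : ℝ) * (W : ℝ) * max (X / Z) Z)) := by
  -- The squared error collects seven factors `T = Z ^ ε`: four from the first mean square, three
  -- from the second. Hence `7 ε = 2 η`.
  set ε : ℝ := 2 * η / 7 with hεdef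
  have hε : 0 < ε := by positivity
  obtain ⟨D, hD1, hD⟩ := exists_card_divisors_le_rpow hε
  set L : ℝ := 1 + 1 / ε with hL
  have hL1 : 1 ≤ L := by
    have : 0 < 1 / ε := by positivity
    linarith
  -- The squared error carries `16 D ^ 5 L ^ 2`; rounding `D ^ 5` up to `D ^ 6` makes this a perfect
  -- square.
  refine ⟨4 * D ^ 3 * L, by positivity, ?_⟩
  intro X Z hX hZ A C W hC hA _
  -- Both sums vanish if either set is empty; otherwise a positive integer in each set forces `Z ≥
  -- 1` and `X ≥ 1`.
  rcases A.eq_empty_or_nonempty with rfl | ⟨a₀, ha₀⟩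
  · simp [solutionSum, solutionMainTerm]
  rcases C.eq_empty_or_nonempty with rfl | ⟨c₀, hc₀⟩
  · simp [solutionSum, solutionMainTerm]
  have hA0 : ∀ a ∈ A, a ≠ 0 := fun a ha => (hA a ha).1.ne_zero
  have hZ1 : 1 ≤ Z := le_trans (by exact_mod_cast Nat.pos_of_ne_zero (hA0 a₀ ha₀)) (hA a₀ ha₀).2.2
  have hX1 : 1 ≤ X := le_trans
    (by exact_mod_cast Nat.pos_of_ne_zero (hC c₀ hc₀).1.ne_zero) (hC c₀ hc₀).2.2
  set m : ℝ := max (X / Z) Z with hm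
  set T : ℝ := Z ^ ε with hT
  have hT1 : 1 ≤ T := Real.one_le_rpow hZ1 hε.le
  have hdiv : ∀ n : ℕ, n ≠ 0 → (n : ℝ) ≤ Z → (#n.divisors : ℝ) ≤ D * T := by
    intro n hn hnZ
    refine (hD n hn).trans ?_
    rw [hT]
    gcongr
  have hW : ∑ a ∈ A, 1 / (a.totient : ℝ) * ((#a.divisors : ℝ) ^ 3 * W) ≤
      #A * ((D * T) ^ 4 * (2 / Z) * W) := by
    rw [← nsmul_eq_mul]
    refine sum_le_card_nsmul _ _ _ fun a ha => ?_
    have hd := hdiv a (hA0 a ha) (hA a ha).2.2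
    have ha0 : (0 : ℝ) < a := by exact_mod_cast Nat.pos_of_ne_zero (hA0 a ha)
    calc 1 / (a.totient : ℝ) * ((#a.divisors : ℝ) ^ 3 * W)
        ≤ #a.divisors / a * ((#a.divisors : ℝ) ^ 3 * W) := by
          exact mul_le_mul_of_nonneg_right (one_div_totient_le (hA0 a ha)) (by positivity)
      _ = (#a.divisors : ℝ) ^ 4 * (1 / a) * W := by ring
      _ ≤ (D * T) ^ 4 * (2 / Z) * W := by
          have : 1 / (a : ℝ) ≤ 2 / Z := by
            rw [div_le_div_iff₀ ha0 hZ]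
            linarith [(hA a ha).2.1]
          gcongr
  set M : ℕ := ⌊Z⌋₊ with hMdef
  -- The extra `1` puts `⌊X⌋₊` itself in `range N`.
  set N : ℕ := ⌊X⌋₊ + 1 with hNdef
  have hM1 : 1 ≤ M := (Nat.one_le_floor_iff Z).mpr hZ1
  have hMZ : (M : ℝ) ≤ Z := Nat.floor_le hZ.le
  have hM0 : (0 : ℝ) < M := by exact_mod_cast hM1
  have hNX : (N : ℝ) ≤ 2 * X := by
    have := Nat.floor_le hX.le
    rw [hNdef]
    push_cast
    linarith
  have hlogM : 1 + Real.log M ≤ L * T :=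
    le_trans (by gcongr) (one_add_log_le_mul_rpow hε hZ1)
  have hlogM0 : 0 ≤ Real.log M := Real.log_natCast_nonneg M
  have htot : ∑ r ∈ Icc 1 M, 1 / (r.totient : ℝ) ≤ D * T * (L * T) := by
    calc ∑ r ∈ Icc 1 M, 1 / (r.totient : ℝ) ≤ ∑ r ∈ Icc 1 M, D * T * (1 / (r : ℝ)) := by
          refine sum_le_sum fun r hr => ?_
          have hr := mem_Icc.mp hr
          have hr0 : r ≠ 0 := by omega
          refine (one_div_totient_le hr0).trans ?_
          rw [mul_one_div]
          gcongr
          exact hdiv r hr0 (le_trans (by exact_mod_cast hr.2) hMZ)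
      _ = D * T * ∑ r ∈ Icc 1 M, 1 / (r : ℝ) := by rw [mul_sum]
      _ ≤ D * T * (L * T) := by
          gcongr
          exact (sum_Icc_one_div_le M).trans hlogM
  have hsieve : (N + 2 * ((M ^ 2 : ℕ) * (1 + Real.log (M ^ 2 : ℕ))) : ℝ) ≤
      8 * (L * T) * (Z * m) := by
    have h1 : X ≤ Z * m := by
      calc X = Z * (X / Z) := by field_simp
        _ ≤ Z * m := by gcongr; exact le_max_left _ _
    have h2 : (M : ℝ) ^ 2 ≤ Z * m := by
      calc (M : ℝ) ^ 2 ≤ Z ^ 2 := by gcongr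
        _ = Z * Z := sq Z
        _ ≤ Z * m := by gcongr; exact le_max_right _ _
    have h3 : 1 ≤ L * T := one_le_mul_of_one_le_of_one_le hL1 hT1
    have h4 : 1 + Real.log (M ^ 2 : ℕ) ≤ 2 * (L * T) := by
      push_cast
      rw [Real.log_pow]
      push_cast
      linarith
    have h5 : 0 ≤ Z * m := hX.le.trans h1
    calc (N + 2 * ((M ^ 2 : ℕ) * (1 + Real.log (M ^ 2 : ℕ))) : ℝ)
        ≤ 2 * (Z * m) + 2 * ((Z * m) * (2 * (L * T))) := by
          have h6 : ((M ^ 2 : ℕ) : ℝ) ≤ Z * m := by exact_mod_cast h2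
          have h7 : 0 ≤ Real.log (M ^ 2 : ℕ) := Real.log_natCast_nonneg _
          gcongr
          linarith
      _ ≤ 8 * (L * T) * (Z * m) := by nlinarith
  have hCr : C ⊆ range N := fun c hc =>
    mem_range.mpr (Nat.lt_succ_of_le (Nat.le_floor (hC c hc).2.2))
  have hCsum := DirichletCharacter.sum_totient_inv_mul_conductor_le A C hM1
    (fun a ha => ⟨hA0 a ha, Nat.le_floor (hA a ha).2.2⟩) hCr
  have hm0 : 0 < m := lt_max_of_lt_right hZ
  have hsq : (solutionSum A C W - solutionMainTerm A C W) ^ 2 ≤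
      16 * D ^ 5 * L ^ 2 * T ^ 7 * (#A * #C * W * m) := by
    calc _ ≤ _ := sq_solutionSum_sub_solutionMainTerm_le A C W hA0
      _ ≤ (#A * ((D * T) ^ 4 * (2 / Z) * W)) *
            ((D * T * (L * T)) * (8 * (L * T) * (Z * m) * #C)) := by
          gcongr
          refine hCsum.trans ?_
          gcongr
      _ = _ := by
          field_simp
          ring
  have hTη : T ^ 7 ≤ ((X * Z) ^ η) ^ 2 := by
    rw [hT, ← Real.rpow_natCast, ← Real.rpow_mul hZ.le, ← Real.rpow_natCast ((X * Z) ^ η),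
      ← Real.rpow_mul (by positivity)]
    have : ε * (7 : ℕ) = η * (2 : ℕ) := by
      rw [hεdef]
      push_cast
      ring
    rw [this]
    have : Z ≤ X * Z := le_mul_of_one_le_left hZ.le hX1
    gcongr
  refine abs_le_of_sq_le_sq ?_ (by positivity)
  rw [mul_pow, mul_pow ((X * Z) ^ η), Real.sq_sqrt (by positivity)]
  calc _ ≤ _ := hsq
    _ ≤ 16 * D ^ 6 * L ^ 2 * ((X * Z) ^ η) ^ 2 * (#A * #C * W * m) := by
        gcongr
        norm_num
    _ = _ := by ring
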